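/- Let $K$ be a field of characteristic zero, let $X=x_1,\dots,x_n$ and $Y=y_1,\dots,y_m$ be two disjoint lists of variables, and regard $K[X]$ and $K[Y]$ as subrings of $K[X,Y]$. For an ideal $I$ of $K[X,Y]$, let $$A(I)=\{(f,g)\in K[X]\times K[Y] : f-g\in I\},$$ a unital $K$-algebra under component-wise operations (with unit $(1,1)$), called the algebra of separated elements of $I$. For every $p\in K[X,Y]\setminus(K[X]\cup K[Y])$, the algebra $A(\langle p\rangle)$ of the principal ideal $\langle p\rangle$ is simple, that is, it is generated as a unital $K$-algebra by a single element: there is $(f,g)\in K[X]\times K[Y]$ with $$A(\langle p\rangle)=\{(h(f),h(g)) : h\in K[t]\}.$$ -/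

import Mathlib

open MvPolynomial

noncomputable section

/-- The inclusion `K[X] → K[X, Y]`, where `X = x₁, …, xₙ` and `Y = y₁, …, yₘ`. -/
def inclX (K : Type*) [Field K] (n m : ℕ) :
    MvPolynomial (Fin n) K →ₐ[K] MvPolynomial (Fin n ⊕ Fin m) K :=
  rename Sum.inl

/-- The inclusion `K[Y] → K[X, Y]`. -/
def inclY (K : Type*) [Field K] (n m : ℕ) :
    MvPolynomial (Fin m) K →ₐ[K] MvPolynomial (Fin n ⊕ Fin m) K :=
  rename Sum.inr

/-- The algebra `A(I)` of separated elements of an ideal `I` of `K[X, Y]`: the unital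
`K`-algebra of all pairs `(f, g)` in `K[X] × K[Y]` with `f - g ∈ I`, with component-wise
operations. -/
def separatedAlgebra {K : Type*} [Field K] {n m : ℕ}
    (I : Ideal (MvPolynomial (Fin n ⊕ Fin m) K)) :
    Subalgebra K (MvPolynomial (Fin n) K × MvPolynomial (Fin m) K) where
  carrier := {a | inclX K n m a.1 - inclY K n m a.2 ∈ I}
  mul_mem' := by
    intro a b ha hb
    have h := I.add_mem (I.mul_mem_right (inclX K n m b.1) ha)
      (I.mul_mem_left (inclY K n m a.2) hb)
    simp only [Set.mem_ofPred_eq, Prod.fst_mul, Prod.snd_mul, map_mul]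
    convert h using 1
    ring
  add_mem' := by
    intro a b ha hb
    have h := I.add_mem ha hb
    simp only [Set.mem_ofPred_eq, Prod.fst_add, Prod.snd_add, map_add]
    convert h using 1
    ring
  algebraMap_mem' := by
    intro c
    simp only [Set.mem_ofPred_eq, Prod.algebraMap_apply, AlgHom.commutes, sub_self]
    exact I.zero_mem

/-- A unital subalgebra is simple if it is generated, as a unital algebra, by one element. -/
def IsSimplyGenerated {K : Type*} [Field K] {B : Type*} [CommRing B] [Algebra K B]
    (A : Subalgebra K B) : Prop :=
  ∃ a : B, A = Algebra.adjoin K {a}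

end

/-! Write `A` for the algebra of separated elements, and suppose it is not just `K`. Since factors
of a polynomial in `X` alone (or `Y` alone) involve no other variables, both projections of `A` are
injective. Restricting the second component to a line along which `p` is not constant embeds `A`
into `K[t]`. By Lüroth the fraction field of `A` is `K(u)`, where `u` may be chosen to correspond to
a polynomial in `t`; then every element of `A` is a polynomial in `u`, and `u` is integral over `A`.

Since `K[X]` and `K[Y]` are integrally closed, the projections send `u` to polynomials `V` and `W`,
so each element of `A` is `(h(V), h(W))`. That `(V, W)` lies in `A` follows by cancelling a
denominator of `u` in `K[Y]`: it is coprime to `p`, as a nonunit factor of `p` in `K[Y]` would force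
`A = K`. -/

/-! ### Lüroth's theorem with a polynomial generator -/

open scoped IntermediateField in
/-- A nontrivial intermediate field of `K(t) / K` is generated by an element with a pole at
infinity. -/
theorem RatFunc.exists_adjoin_eq_one_lt_inftyValuation {K : Type*} [Field K]
    [DecidableEq (RatFunc K)] {E : IntermediateField K (RatFunc K)} (hE : E ≠ ⊥) :
    ∃ v : RatFunc K, E = K⟮v⟯ ∧ 1 < inftyValuation K v := by
  have key : ∀ v : RatFunc K, v ≠ 0 → inftyValuation K v < 1 → E = K⟮v⟯ →
      ∃ v : RatFunc K, E = K⟮v⟯ ∧ 1 < inftyValuation K v := by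
    intro v hv0 hv h
    refine ⟨v⁻¹, ?_, ?_⟩
    · rw [h]
      apply le_antisymm <;> rw [IntermediateField.adjoin_simple_le_iff]
      · simpa using inv_mem (IntermediateField.mem_adjoin_simple_self K v⁻¹)
      · exact inv_mem (IntermediateField.mem_adjoin_simple_self K v)
    · rw [map_inv₀]
      exact (one_lt_inv₀ (by simpa [zero_lt_iff] using hv0)).2 hv
  set v := Luroth.generator E with hvdef
  have hgen : E = K⟮v⟯ := Luroth.eq_adjoin_generator
  have hne : ¬ ∃ c, v = C c := Luroth.generator_ne_C hE
  have hv0 : v ≠ 0 := Luroth.generator_ne_zero hE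
  rcases lt_trichotomy (inftyValuation K v) 1 with h | h | h
  · exact key v hv0 h hgen
  · rw [inftyValuation_apply, inftyValuation_of_nonzero K hv0, WithZero.exp_eq_one,
      RatFunc.intDegree, sub_eq_zero, Nat.cast_inj] at h
    -- `c` is the value of `v` at infinity, so `v - c` vanishes there and its inverse has a pole.
    set c := v.num.leadingCoeff / v.denom.leadingCoeff with hc
    have hn0 : v.num ≠ 0 := RatFunc.num_ne_zero hv0
    have hd0 : v.denom ≠ 0 := RatFunc.denom_ne_zero v
    have hc0 : c ≠ 0 := by simp [hc, hn0, hd0]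
    have hvc : v - C c ≠ 0 := fun H => hne ⟨c, sub_eq_zero.1 H⟩
    have heq : (v - C c) * algebraMap (Polynomial K) (RatFunc K) v.denom =
        algebraMap (Polynomial K) (RatFunc K) (v.num - Polynomial.C c * v.denom) := by
      rw [map_sub, map_mul, RatFunc.algebraMap_C, sub_mul]
      congr 1
      exact (div_eq_iff (by simpa using hd0)).1 (RatFunc.num_div_denom v) |>.symm
    have hp0 : v.num - Polynomial.C c * v.denom ≠ 0 := by
      intro H
      rw [H, map_zero] at heq
      simp [hvc, hd0] at heq
    have hdeg : (v.num - Polynomial.C c * v.denom).natDegree < v.denom.natDegree := by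
      rw [← h]
      apply Polynomial.natDegree_lt_natDegree hp0
      apply Polynomial.degree_sub_lt_left _ hn0
      · simp [hc, hd0]
      · rw [Polynomial.degree_C_mul hc0, Polynomial.degree_eq_natDegree hn0,
          Polynomial.degree_eq_natDegree hd0, h]
    refine key (v - C c) hvc ?_ ?_
    · have := congrArg RatFunc.intDegree heq
      rw [RatFunc.intDegree_mul hvc (by simpa using hd0), RatFunc.intDegree_polynomial,
        RatFunc.intDegree_polynomial] at this
      rw [inftyValuation_apply, inftyValuation_of_nonzero K hvc, ← WithZero.exp_zero,
        WithZero.exp_lt_exp]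
      omega
    · have hC : ∀ F : IntermediateField K (RatFunc K), C c ∈ F := fun F => by
        rw [← RatFunc.algebraMap_eq_C]; exact F.algebraMap_mem c
      rw [hgen]
      apply le_antisymm <;> rw [IntermediateField.adjoin_simple_le_iff]
      · simpa using add_mem (IntermediateField.mem_adjoin_simple_self K (v - C c)) (hC _)
      · exact sub_mem (IntermediateField.mem_adjoin_simple_self K v) (hC _)
  · exact ⟨v, hgen, h⟩

open scoped IntermediateField in
/-- An element of `k(v)` is a quotient of coprime polynomial expressions in `v`. -/
theorem IntermediateField.exists_isCoprime_of_mem_adjoin_simple {k L : Type*} [Field k] [Field L]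
    [Algebra k L] {v x : L} (hx : x ∈ k⟮v⟯) :
    ∃ P Q : Polynomial k, IsCoprime P Q ∧ Polynomial.aeval v Q ≠ 0 ∧
      x * Polynomial.aeval v Q = Polynomial.aeval v P := by
  classical
  obtain ⟨r, s, h⟩ := (IntermediateField.mem_adjoin_simple_iff k x).1 hx
  by_cases hs : Polynomial.aeval v s = 0
  · exact ⟨0, 1, isCoprime_zero_left.2 isUnit_one, by simp, by simp [h, hs]⟩
  · have hs0 : s ≠ 0 := by rintro rfl; simp at hs
    obtain ⟨r', hr⟩ := EuclideanDomain.gcd_dvd_left r s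
    obtain ⟨s', hs'⟩ := EuclideanDomain.gcd_dvd_right r s
    set g := EuclideanDomain.gcd r s with hg
    have hg0 : g ≠ 0 := by rintro H; rw [H, zero_mul] at hs'; exact hs0 hs'
    have hcop : IsCoprime r' s' := by
      have := EuclideanDomain.gcd_eq_gcd_ab r s
      rw [← hg] at this
      refine ⟨EuclideanDomain.gcdA r s, EuclideanDomain.gcdB r s, mul_left_cancel₀ hg0 ?_⟩
      linear_combination -this - EuclideanDomain.gcdA r s * hr - EuclideanDomain.gcdB r s * hs'
    rw [hs', map_mul] at hs
    refine ⟨r', s', hcop, right_ne_zero_of_mul hs, ?_⟩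
    have h1 := left_ne_zero_of_mul hs
    have h2 := right_ne_zero_of_mul hs
    rw [h, hr, hs', map_mul, map_mul]
    field_simp

open scoped IntermediateField in
/-- Lüroth's theorem for an intermediate field containing a nonconstant polynomial: the
generator can be taken to be a polynomial. -/
theorem RatFunc.exists_polynomial_adjoin_eq {K : Type*} [Field K]
    {E : IntermediateField K (RatFunc K)} {f : Polynomial K} (hf : 0 < f.natDegree)
    (hfE : algebraMap (Polynomial K) (RatFunc K) f ∈ E) :
    ∃ w : Polynomial K, E = K⟮algebraMap (Polynomial K) (RatFunc K) w⟯ ∧ 0 < w.natDegree := by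
  classical
  have hf0 : f ≠ 0 := by rintro rfl; simp at hf
  have hfval : 1 < inftyValuation K (algebraMap (Polynomial K) (RatFunc K) f) := by
    rw [inftyValuation_apply, inftyValuation.polynomial K hf0, ← WithZero.exp_zero,
        WithZero.exp_lt_exp]
    exact_mod_cast hf
  have hE : E ≠ ⊥ := by
    rintro rfl
    obtain ⟨c, hc⟩ := IntermediateField.mem_bot.1 hfE
    rw [← hc, RatFunc.algebraMap_eq_C] at hfval
    by_cases h0 : c = 0
    · simp [h0] at hfval
    · simp [inftyValuation.C K h0] at hfval
  obtain ⟨v, hv, hval⟩ := RatFunc.exists_adjoin_eq_one_lt_inftyValuation hE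
  rw [hv] at hfE
  obtain ⟨P, Q, -, hQ, hPQ⟩ := IntermediateField.exists_isCoprime_of_mem_adjoin_simple hfE
  have hQ0 : Q ≠ 0 := by rintro rfl; simp at hQ
  have hP0 : P ≠ 0 := by
    rintro rfl
    simp [hf0, hQ] at hPQ
  -- As `v` has a pole at infinity, the pole order of `P(v)` is proportional to `deg P`, and
  -- likewise for `Q`; their quotient `f` has a pole.
  have hlt : Q.natDegree < P.natDegree := by
    by_contra! hle
    have h1 := Polynomial.valuation_aeval_eq_valuation_X_pow_natDegree_of_one_lt_valuation_X
      (v := inftyValuation K) v hval hP0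
    have h2 := Polynomial.valuation_aeval_eq_valuation_X_pow_natDegree_of_one_lt_valuation_X
      (v := inftyValuation K) v hval hQ0
    rw [← hPQ, map_mul, h2] at h1
    have h3 : inftyValuation K v ^ P.natDegree ≤ inftyValuation K v ^ Q.natDegree :=
      pow_le_pow_right₀ hval.le hle
    rw [← h1] at h3
    have hpos : 0 < inftyValuation K v ^ Q.natDegree := pow_pos (zero_lt_one.trans hval) _
    exact absurd h3 (not_le.2 (lt_mul_of_one_lt_left hpos hfval))
  have hint : IsIntegral (Polynomial K) v := by
    -- `v` is a root of `P - f Q`, whose leading coefficient is that of `P`, a nonzero constant,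
    -- because `deg Q < deg P`.
    set R := P.map Polynomial.C - Polynomial.C f * Q.map Polynomial.C with hR
    have hdlt : (Polynomial.C f * Q.map Polynomial.C).natDegree < P.natDegree :=
      (Polynomial.natDegree_C_mul_le _ _).trans_lt (by
        rwa [Polynomial.natDegree_map_eq_of_injective (Polynomial.C_injective)])
    have hPn : (P.map (Polynomial.C : K →+* Polynomial K)).natDegree = P.natDegree :=
      Polynomial.natDegree_map_eq_of_injective (Polynomial.C_injective) _
    have hRlead : R.leadingCoeff = Polynomial.C P.leadingCoeff := by
      rw [hR, Polynomial.leadingCoeff_sub_of_degree_lt, Polynomial.leadingCoeff_map_of_injective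
        Polynomial.C_injective]
      apply Polynomial.degree_lt_degree
      rwa [hPn]
    have hmap : ∀ T : Polynomial K, Polynomial.aeval v (T.map (Polynomial.C : K →+* Polynomial K))
        = Polynomial.aeval v T := fun T => by
      rw [Polynomial.aeval_def, Polynomial.eval₂_map, Polynomial.aeval_def]
      rfl
    have hroot : Polynomial.aeval v R = 0 := by
      rw [hR, map_sub, map_mul, hmap, hmap, Polynomial.aeval_C, hPQ, sub_self]
    refine ⟨Polynomial.C (Polynomial.C P.leadingCoeff⁻¹) * R, ?_, ?_⟩
    · rw [Polynomial.Monic, Polynomial.leadingCoeff_mul, Polynomial.leadingCoeff_C, hRlead,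
        ← map_mul, inv_mul_cancel₀ (by simpa using hP0), map_one]
    · rw [← Polynomial.aeval_def, map_mul, hroot, mul_zero]
  obtain ⟨w, rfl⟩ := IsIntegrallyClosed.isIntegral_iff.1 hint
  have hw0 : w ≠ 0 := by rintro rfl; simp at hval
  refine ⟨w, hv, ?_⟩
  rw [inftyValuation_apply, inftyValuation.polynomial K hw0, ← WithZero.exp_zero,
        WithZero.exp_lt_exp] at hval
  exact_mod_cast hval

open scoped IntermediateField in
/-- A polynomial that is a rational function of a polynomial `w` is a polynomial in `w`. -/
theorem RatFunc.exists_comp_eq_of_mem_adjoin {K : Type*} [Field K] {w r : Polynomial K}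
    (hw : 0 < w.natDegree)
    (hr : algebraMap (Polynomial K) (RatFunc K) r ∈ K⟮algebraMap (Polynomial K) (RatFunc K) w⟯) :
    ∃ h : Polynomial K, Polynomial.aeval w h = r := by
  obtain ⟨P, Q, ⟨U, V, hUV⟩, hQ, hPQ⟩ :=
    IntermediateField.exists_isCoprime_of_mem_adjoin_simple hr
  rw [Polynomial.aeval_algebraMap_apply, Polynomial.aeval_algebraMap_apply, ← map_mul] at hPQ
  replace hPQ := RatFunc.algebraMap_injective K hPQ
  -- Bézout for `P`, `Q` and `P(w) = r Q(w)` give `(U(w) r + V(w)) Q(w) = 1`.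
  have hunit : IsUnit (Polynomial.aeval w Q) := by
    refine IsUnit.of_mul_eq_one (Polynomial.aeval w U * r + Polynomial.aeval w V) ?_
    have := congrArg (Polynomial.aeval w) hUV
    rw [map_add, map_mul, map_mul, map_one, ← hPQ] at this
    linear_combination this
  have hQdeg := Polynomial.natDegree_eq_zero_of_isUnit hunit
  rw [← Polynomial.comp_eq_aeval, Polynomial.natDegree_comp] at hQdeg
  obtain ⟨c, rfl⟩ := Polynomial.natDegree_eq_zero.1 ((mul_eq_zero.1 hQdeg).resolve_right hw.ne')
  have hc : c ≠ 0 := by rintro rfl; simp at hQ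
  refine ⟨Polynomial.C c⁻¹ * P, ?_⟩
  rw [map_mul, ← hPQ, Polynomial.aeval_C, Polynomial.aeval_C, mul_comm r, ← mul_assoc, ← map_mul,
    inv_mul_cancel₀ hc, map_one, one_mul]
-- Factors, specializations and restriction to lines
/-- A divisor of a nonzero polynomial in fewer variables lies in the same polynomial ring. -/
theorem MvPolynomial.mem_range_rename_of_dvd {σ τ R : Type*} [CommRing R] [IsDomain R]
    {f : σ → τ} (hf : Function.Injective f) {d : MvPolynomial τ R} {b : MvPolynomial σ R}
    (hb : b ≠ 0) (h : d ∣ rename f b) : d ∈ (rename f : MvPolynomial σ R →ₐ[R] _).range := by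
  classical
  obtain ⟨s, hs⟩ := h
  have hfb : rename f b ≠ 0 := (map_ne_zero_iff _ (rename_injective f hf)).2 hb
  have hd0 : d ≠ 0 := by rintro rfl; simp [hs] at hfb
  have hs0 : s ≠ 0 := by rintro rfl; simp [hs] at hfb
  refine exists_rename_eq_of_vars_subset_range d f hf fun i hi => ?_
  have hi' := mem_vars_iff_degreeOf_ne_zero.1 hi
  have h1 : i ∈ (rename f b).vars := by
    rw [mem_vars_iff_degreeOf_ne_zero, hs, degreeOf_mul_eq hd0 hs0]
    omega
  obtain ⟨j, -, hj⟩ := Finset.mem_image.1 (vars_rename f b h1)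
  exact ⟨j, hj⟩

section

variable {K : Type*} [Field K] {n m : ℕ}

/-- Specialization of `Y` at a point. -/
noncomputable def evalY (n : ℕ) {m : ℕ} (y : Fin m → K) :
    MvPolynomial (Fin n ⊕ Fin m) K →ₐ[K] MvPolynomial (Fin n) K :=
  aeval (Sum.elim X fun j => C (y j))

@[simp]
theorem evalY_inclX (y : Fin m → K) (f : MvPolynomial (Fin n) K) :
    evalY n y (inclX K n m f) = f := by
  have : (evalY n y).comp (inclX K n m) = AlgHom.id K _ := by
    ext i : 1
    simp [evalY, inclX]
  simpa using DFunLike.congr_fun this f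

theorem eval_evalY (x : Fin n → K) (y : Fin m → K) (p : MvPolynomial (Fin n ⊕ Fin m) K) :
    eval x (evalY n y p) = eval (Sum.elim x y) p := by
  have : (aeval x).comp (evalY n y) = (aeval (Sum.elim x y) : _ →ₐ[K] K) := by
    ext (i | j) <;> simp [evalY]
  simpa using DFunLike.congr_fun this p

/-- A polynomial whose specializations at points `y` all agree does not involve `Y`. -/
theorem mem_range_inclX_of_evalY_eq [Infinite K] {p : MvPolynomial (Fin n ⊕ Fin m) K}
    (h : ∀ y : Fin m → K, evalY n y p = evalY n 0 p) : p ∈ (inclX K n m).range := by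
  refine ⟨evalY n 0 p, MvPolynomial.funext fun z => ?_⟩
  obtain ⟨x, y, rfl⟩ : ∃ x y, z = Sum.elim x y := ⟨z ∘ Sum.inl, z ∘ Sum.inr, by simp⟩
  rw [← eval_evalY, ← eval_evalY, ← h y]
  simp

/-- Restriction of `Y` to the line through `a` and `b`, parametrized by a new variable. -/
noncomputable def lineY (n : ℕ) {m : ℕ} (a b : Fin m → K) :
    MvPolynomial (Fin n ⊕ Fin m) K →ₐ[K] Polynomial (MvPolynomial (Fin n) K) :=
  aeval (Sum.elim (fun i => Polynomial.C (X i))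
    fun j => Polynomial.C (C (a j)) + Polynomial.X * Polynomial.C (C (b j - a j)))

/-- Restriction of a polynomial to the line through `a` and `b`. -/
noncomputable def lineRestrict {m : ℕ} (a b : Fin m → K) :
    MvPolynomial (Fin m) K →ₐ[K] Polynomial K :=
  aeval fun j => Polynomial.C (a j) + Polynomial.X * Polynomial.C (b j - a j)

theorem lineY_inclX (a b : Fin m → K) (f : MvPolynomial (Fin n) K) :
    lineY n a b (inclX K n m f) = Polynomial.C f := by
  have : (lineY n a b).comp (inclX K n m) = Polynomial.CAlgHom := by
    ext i : 1
    simp [lineY, inclX]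
  simpa using DFunLike.congr_fun this f

theorem lineY_inclY (a b : Fin m → K) (g : MvPolynomial (Fin m) K) :
    lineY n a b (inclY K n m g) = (lineRestrict a b g).map C := by
  have : (lineY n a b).comp (inclY K n m) =
      (Polynomial.mapAlgHom (Algebra.ofId K (MvPolynomial (Fin n) K))).comp
        (lineRestrict a b) := by
    ext j : 1
    simp [lineY, inclY, lineRestrict, algebraMap_eq]
  simpa using DFunLike.congr_fun this g

theorem eval_zero_lineY (a b : Fin m → K) (p : MvPolynomial (Fin n ⊕ Fin m) K) :
    (lineY n a b p).eval 0 = evalY n a p := by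
  have : ((Polynomial.aeval (0 : MvPolynomial (Fin n) K)).restrictScalars K).comp (lineY n a b)
      = evalY n a := by
    ext (i | j) : 1 <;> simp [lineY, evalY]
  simpa using DFunLike.congr_fun this p

theorem eval_one_lineY (a b : Fin m → K) (p : MvPolynomial (Fin n ⊕ Fin m) K) :
    (lineY n a b p).eval 1 = evalY n b p := by
  have : ((Polynomial.aeval (1 : MvPolynomial (Fin n) K)).restrictScalars K).comp (lineY n a b)
      = evalY n b := by
    ext (i | j) : 1 <;> simp [lineY, evalY]
  simpa using DFunLike.congr_fun this p

theorem mem_separatedAlgebra_span {p : MvPolynomial (Fin n ⊕ Fin m) K}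
    {c : MvPolynomial (Fin n) K × MvPolynomial (Fin m) K} :
    c ∈ separatedAlgebra (Ideal.span {p}) ↔ p ∣ inclX K n m c.1 - inclY K n m c.2 :=
  Ideal.mem_span_singleton

theorem snd_eq_zero_of_fst_eq_zero {p : MvPolynomial (Fin n ⊕ Fin m) K}
    (hpY : p ∉ (inclY K n m).range) {c : MvPolynomial (Fin n) K × MvPolynomial (Fin m) K}
    (hc : c ∈ separatedAlgebra (Ideal.span {p})) (h : c.1 = 0) : c.2 = 0 := by
  by_contra h2
  rw [mem_separatedAlgebra_span, h, map_zero, zero_sub, dvd_neg] at hc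
  exact hpY (mem_range_rename_of_dvd Sum.inr_injective h2 hc)

theorem fst_eq_zero_of_snd_eq_zero {p : MvPolynomial (Fin n ⊕ Fin m) K}
    (hpX : p ∉ (inclX K n m).range) {c : MvPolynomial (Fin n) K × MvPolynomial (Fin m) K}
    (hc : c ∈ separatedAlgebra (Ideal.span {p})) (h : c.2 = 0) : c.1 = 0 := by
  by_contra h2
  rw [mem_separatedAlgebra_span, h, map_zero, sub_zero] at hc
  exact hpX (mem_range_rename_of_dvd Sum.inl_injective h2 hc)

/-- If `p` involves `Y`, then its separated elements embed into `K[t]` by restricting the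
`Y`-component to a suitable line. -/
theorem exists_lineRestrict_injOn [Infinite K] {p : MvPolynomial (Fin n ⊕ Fin m) K}
    (hpX : p ∉ (inclX K n m).range) (hpY : p ∉ (inclY K n m).range) :
    ∃ a b : Fin m → K, ∀ c ∈ separatedAlgebra (Ideal.span {p}),
      lineRestrict a b c.2 = 0 → c = 0 := by
  obtain ⟨b, hb⟩ : ∃ b : Fin m → K, evalY n b p ≠ evalY n 0 p := by
    by_contra! h
    exact hpX (mem_range_inclX_of_evalY_eq h)
  refine ⟨0, b, fun c hc h => ?_⟩
  suffices h1 : c.1 = 0 from Prod.ext h1 (snd_eq_zero_of_fst_eq_zero hpY hc h1)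
  by_contra h1
  obtain ⟨s, hs⟩ := mem_separatedAlgebra_span.1 hc
  replace hs := congrArg (lineY n 0 b) hs
  rw [map_sub, lineY_inclX, lineY_inclY, h, Polynomial.map_zero, sub_zero, map_mul] at hs
  -- On the line `p` divides the nonzero `c.1`, which is constant in `t`; so `p` has the same value
  -- at `t = 0` and `t = 1`, against the choice of `b`.
  have hunit : (lineY n 0 b p).natDegree = 0 := by
    have h2 : lineY n 0 b p * lineY n 0 b s ≠ 0 := by
      rw [← hs]; simpa using h1
    have h3 := congrArg Polynomial.natDegree hs
    rw [Polynomial.natDegree_mul (left_ne_zero_of_mul h2) (right_ne_zero_of_mul h2),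
      Polynomial.natDegree_C] at h3
    omega
  obtain ⟨q, hq⟩ := Polynomial.natDegree_eq_zero.1 hunit
  rw [← eval_one_lineY 0 b, ← eval_zero_lineY 0 b, ← hq] at hb
  simp at hb

/-- Specialization of `X` at a point. -/
noncomputable def evalX {n : ℕ} (m : ℕ) (x : Fin n → K) :
    MvPolynomial (Fin n ⊕ Fin m) K →ₐ[K] MvPolynomial (Fin m) K :=
  aeval (Sum.elim (fun i => C (x i)) X)

@[simp]
theorem evalX_inclY (x : Fin n → K) (g : MvPolynomial (Fin m) K) :
    evalX m x (inclY K n m g) = g := by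
  have : (evalX m x).comp (inclY K n m) = AlgHom.id K _ := by
    ext i : 1
    simp [evalX, inclY]
  simpa using DFunLike.congr_fun this g

@[simp]
theorem evalX_inclX (x : Fin n → K) (f : MvPolynomial (Fin n) K) :
    evalX m x (inclX K n m f) = C (eval x f) := by
  have : ((evalX m x).comp (inclX K n m)) = (Algebra.ofId K _).comp (aeval x) := by
    ext j
    simp [evalX, inclX, Algebra.ofId_apply, algebraMap_eq]
  simpa [Algebra.ofId_apply, algebraMap_eq] using DFunLike.congr_fun this f

/-- If `p` has a nontrivial factor in `K[Y]`, then all its separated elements are constant. -/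
theorem separatedAlgebra_span_eq_bot_of_dvd [Infinite K]
    {p : MvPolynomial (Fin n ⊕ Fin m) K} (hpY : p ∉ (inclY K n m).range)
    {d : MvPolynomial (Fin m) K} (hd : ¬ IsUnit d)
    (hdp : inclY K n m d ∣ p) : separatedAlgebra (Ideal.span {p}) = ⊥ := by
  rw [eq_bot_iff]
  intro c hc
  have hc1 : c.1 = C (eval 0 c.1) := by
    refine MvPolynomial.funext fun x => ?_
    have h := hdp.trans (mem_separatedAlgebra_span.1 hc)
    have hx : ∀ x, d ∣ C (eval x c.1) - c.2 := fun x => by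
      simpa only [map_sub, evalX_inclX, evalX_inclY] using map_dvd (evalX m x) h
    -- Subtracting eliminates `c.2`: the nonunit `d` divides a constant, which must vanish.
    have h2 := dvd_sub (hx x) (hx 0)
    rw [sub_sub_sub_cancel_right, ← C_sub] at h2
    rw [eval_C]
    by_contra h3
    exact hd (isUnit_of_dvd_unit h2 ((isUnit_iff_ne_zero.2 (sub_ne_zero.2 h3)).map C))
  have hmem : c - algebraMap K _ (eval 0 c.1) ∈ separatedAlgebra (Ideal.span {p}) :=
    sub_mem hc (Subalgebra.algebraMap_mem _ _)
  have h1 : (c - algebraMap K _ (eval 0 c.1)).1 = 0 := sub_eq_zero.2 hc1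
  exact Algebra.mem_bot.2 ⟨eval 0 c.1,
    (sub_eq_zero.1 (Prod.ext h1 (snd_eq_zero_of_fst_eq_zero hpY hmem h1))).symm⟩

end
-- The generator in the fraction field and its images
/-- A nontrivial domain that embeds into `K[t]` consists of polynomials in one element `u` of its
integral closure. -/
theorem exists_isIntegral_forall_eq_aeval {K A : Type*} [Field K] [CommRing A] [IsDomain A]
    [Algebra K A] (ι : A →ₐ[K] Polynomial K) (hι : Function.Injective ι)
    (hA : ∃ c : A, c ∉ Set.range (algebraMap K A)) :
    ∃ u : FractionRing A, IsIntegral A u ∧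
      (∃ a b : A, b ≠ 0 ∧ algebraMap A (FractionRing A) b * u = algebraMap A _ a) ∧
      ∀ c : A, ∃ h : Polynomial K, Polynomial.aeval u h = algebraMap A (FractionRing A) c := by
  let κ : A →ₐ[K] RatFunc K :=
    (IsScalarTower.toAlgHom K (Polynomial K) (RatFunc K)).comp ι
  have hκ : Function.Injective κ := (RatFunc.algebraMap_injective K).comp hι
  let j : FractionRing A →ₐ[K] RatFunc K := IsFractionRing.liftAlgHom hκ
  have hj : ∀ a, j (algebraMap A _ a) = algebraMap _ _ (ι a) := fun a =>
    IsFractionRing.lift_algebraMap hκ a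
  have hmem : ∀ a, algebraMap (Polynomial K) (RatFunc K) (ι a) ∈ j.fieldRange := fun a =>
    ⟨_, hj a⟩
  obtain ⟨c, hc⟩ := hA
  have hdeg : ∀ c, c ∉ Set.range (algebraMap K A) → 0 < (ι c).natDegree := by
    intro c hc
    rw [pos_iff_ne_zero]
    intro h
    obtain ⟨e, he⟩ := Polynomial.natDegree_eq_zero.1 h
    exact hc ⟨e, hι (by rw [← he, AlgHom.commutes]; rfl)⟩
  obtain ⟨w, hw, hw0⟩ := RatFunc.exists_polynomial_adjoin_eq (hdeg c hc) (hmem c)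
  obtain ⟨u, hu⟩ : algebraMap (Polynomial K) (RatFunc K) w ∈ j.fieldRange := by
    rw [hw]
    exact IntermediateField.mem_adjoin_simple_self K _
  have hrep : ∀ c : A, ∃ h : Polynomial K,
      Polynomial.aeval u h = algebraMap A (FractionRing A) c := by
    intro c
    obtain ⟨h, hh⟩ := RatFunc.exists_comp_eq_of_mem_adjoin hw0 (hw ▸ hmem c)
    refine ⟨h, j.toRingHom.injective ?_⟩
    change j _ = j _
    rw [hj, ← hh, ← Polynomial.aeval_algHom_apply, ← Polynomial.aeval_algebraMap_apply, ← hu]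
    rfl
  refine ⟨u, ?_, ?_, hrep⟩
  swap
  · obtain ⟨a, b, hb, rfl⟩ := IsFractionRing.div_surjective (A := A) u
    have hb0 : b ≠ 0 := nonZeroDivisors.ne_zero hb
    exact ⟨a, b, hb0, mul_div_cancel₀ _ (by simpa using hb0)⟩
  obtain ⟨h, hh⟩ := hrep c
  have hh0 : 0 < h.natDegree := by
    rw [pos_iff_ne_zero]
    intro H
    obtain ⟨e, rfl⟩ := Polynomial.natDegree_eq_zero.1 H
    refine hc ⟨e, IsFractionRing.injective A (FractionRing A) ?_⟩
    rw [← hh, Polynomial.aeval_C, ← IsScalarTower.algebraMap_apply]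
  have hh1 : h ≠ 0 := by rintro rfl; simp at hh0
  have hmonic := Polynomial.monic_mul_leadingCoeff_inv hh1
  -- `u` is integral because a monic nonconstant polynomial in `u`, a scalar multiple of `h(u) = c`,
  -- lies in `A`.
  refine IsIntegral.of_aeval_monic (hmonic.map (algebraMap K A)) ?_ ?_
  · rw [hmonic.natDegree_map, Polynomial.natDegree_mul_leadingCoeff_inv _ hh1]
    exact hh0.ne'
  · rw [Polynomial.aeval_map_algebraMap, map_mul, hh, Polynomial.aeval_C,
      IsScalarTower.algebraMap_apply K A, ← map_mul]
    exact isIntegral_algebraMap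

/-- An embedding of a domain `A` into an integrally closed domain `S` extends to the integral
elements of the fraction field of `A`. -/
theorem exists_algebraMap_eq_liftAlgHom {K A S : Type*} [Field K] [CommRing A] [IsDomain A]
    [Algebra K A] [CommRing S] [IsDomain S] [IsIntegrallyClosed S] [Algebra K S] (π : A →ₐ[K] S)
    (hπ : Function.Injective π) {u : FractionRing A} (hu : IsIntegral A u) {a b : A}
    (hab : algebraMap A (FractionRing A) b * u = algebraMap A (FractionRing A) a) :
    ∃ W : S, π b * W = π a ∧ ∀ (c : A) (h : Polynomial K),
      Polynomial.aeval u h = algebraMap A (FractionRing A) c → Polynomial.aeval W h = π c := by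
  let κ : A →ₐ[K] FractionRing S := (IsScalarTower.toAlgHom K S (FractionRing S)).comp π
  have hκ : Function.Injective κ := (IsFractionRing.injective S (FractionRing S)).comp hπ
  let j : FractionRing A →ₐ[K] FractionRing S := IsFractionRing.liftAlgHom hκ
  have hj : ∀ a, j (algebraMap A _ a) = algebraMap _ _ (π a) := fun a =>
    IsFractionRing.lift_algebraMap hκ a
  have hint : IsIntegral S (j u) :=
    hu.map_of_comp_eq π.toRingHom j.toRingHom (RingHom.ext fun a => (hj a).symm)
  obtain ⟨W, hW⟩ := IsIntegrallyClosed.isIntegral_iff.1 hint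
  refine ⟨W, IsFractionRing.injective S (FractionRing S) ?_, fun c h hc =>
    IsFractionRing.injective S (FractionRing S) ?_⟩
  · rw [map_mul, hW, ← hj, ← hj, ← map_mul, hab]
  · rw [← Polynomial.aeval_algebraMap_apply, hW, Polynomial.aeval_algHom_apply, hc, hj]

/-! ### Descent to `K[X] × K[Y]` -/

theorem mainTheorem2 {K : Type*} [Field K] [CharZero K] (n m : ℕ)
    (p : MvPolynomial (Fin n ⊕ Fin m) K)
    (hpX : p ∉ (inclX K n m).range) (hpY : p ∉ (inclY K n m).range) :
    IsSimplyGenerated (separatedAlgebra (Ideal.span {p})) := by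
  by_cases hbot : separatedAlgebra (Ideal.span {p}) = ⊥
  · exact ⟨0, by rw [hbot, Algebra.adjoin_singleton_zero]⟩
  set A := separatedAlgebra (Ideal.span {p}) with hA
  let πX : A →ₐ[K] MvPolynomial (Fin n) K := (AlgHom.fst K _ _).comp A.val
  let πY : A →ₐ[K] MvPolynomial (Fin m) K := (AlgHom.snd K _ _).comp A.val
  have hπX : Function.Injective πX := (injective_iff_map_eq_zero πX).2 fun c hc =>
    Subtype.ext (Prod.ext hc (snd_eq_zero_of_fst_eq_zero hpY c.2 hc))
  have hπY : Function.Injective πY := (injective_iff_map_eq_zero πY).2 fun c hc =>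
    Subtype.ext (Prod.ext (fst_eq_zero_of_snd_eq_zero hpX c.2 hc) hc)
  have : IsDomain A := hπX.isDomain πX.toRingHom
  obtain ⟨y₀, y₁, hline⟩ := exists_lineRestrict_injOn hpX hpY
  let ι : A →ₐ[K] Polynomial K := (lineRestrict y₀ y₁).comp πY
  have hι : Function.Injective ι := (injective_iff_map_eq_zero ι).2 fun c hc =>
    Subtype.ext (hline c c.2 hc)
  have hnontriv : ∃ c : A, c ∉ Set.range (algebraMap K A) := by
    by_contra! h
    refine hbot (eq_bot_iff.2 fun c hc => ?_)
    obtain ⟨e, he⟩ := h ⟨c, hc⟩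
    exact Algebra.mem_bot.2 ⟨e, congrArg Subtype.val he⟩
  obtain ⟨u, hu, ⟨a, b, hb0, hab⟩, hrep⟩ := exists_isIntegral_forall_eq_aeval ι hι hnontriv
  obtain ⟨V, hV, hVrep⟩ := exists_algebraMap_eq_liftAlgHom πX hπX hu hab
  obtain ⟨W, hW, hWrep⟩ := exists_algebraMap_eq_liftAlgHom πY hπY hu hab
  have hVW : (V, W) ∈ A := by
    have hp0 : p ≠ 0 := by rintro rfl; exact hpX (zero_mem _)
    rw [hA, mem_separatedAlgebra_span]
    refine UniqueFactorizationMonoid.dvd_of_dvd_mul_right_of_no_prime_factors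
      (b := inclY K n m (πY b)) hp0 ?_ ?_
    · intro d hdp hdb hd
      obtain ⟨d', rfl⟩ := mem_range_rename_of_dvd Sum.inr_injective
        ((map_ne_zero_iff _ hπY).2 hb0) hdb
      exact hbot (separatedAlgebra_span_eq_bot_of_dvd hpY
        (fun h => hd.not_isUnit (h.map (inclY K n m))) hdp)
    · have ha := mem_separatedAlgebra_span.1 a.2
      have hb := mem_separatedAlgebra_span.1 b.2
      have h1 : inclX K n m (πX b) * inclX K n m V = inclX K n m (πX a) := by rw [← map_mul, hV]
      have h2 : inclY K n m (πY b) * inclY K n m W = inclY K n m (πY a) := by rw [← map_mul, hW]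
      -- With `a = b u`, this difference is `b_Y (V - W)`, where `b_Y` is the `Y`-component of `b`.
      have := dvd_sub ha (hb.mul_right (inclX K n m V))
      convert this using 1
      change _ = (inclX K n m (πX a) - inclY K n m (πY a)) -
        (inclX K n m (πX b) - inclY K n m (πY b)) * inclX K n m V
      linear_combination h1 - h2
  refine ⟨(V, W), le_antisymm (fun c hc => ?_)
    (Algebra.adjoin_le (Set.singleton_subset_iff.2 hVW))⟩
  obtain ⟨h, hh⟩ := hrep ⟨c, hc⟩
  rw [Algebra.adjoin_singleton_eq_range_aeval]
  exact ⟨h, Prod.ext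
    ((Polynomial.aeval_algHom_apply (AlgHom.fst K _ _) (V, W) h).symm.trans (hVrep ⟨c, hc⟩ h hh))
    ((Polynomial.aeval_algHom_apply (AlgHom.snd K _ _) (V, W) h).symm.trans (hWrep ⟨c, hc⟩ h hh))⟩
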